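/- Let $\mathbb F$ be a field and let $\mathcal M$ be a $\Sigma$-module over $\mathbb F$, i.e. a sequence $(\mathcal M(n))_{n\ge 0}$ where $\mathcal M(n)$ is an $\mathbb F$-linear representation of the symmetric group $\Sigma_n$ (no reducedness is assumed). **Notation.** For $p,n\ge 0$ let $\operatorname{Comp}_p(n)$ be the set of $p$-tuples $\underline r=(r_1,\dots,r_p)$ of non-negative integers with sum $n$. Such an $\underline r$ cuts $\{1,\dots,n\}$ into consecutive blocks $\underline r_1,\dots,\underline r_p$ of sizes $r_1,\dots,r_p$; let $\Sigma_{\underline r}=\prod_i\Sigma_{\underline r_i}\subseteq\Sigma_n$ be the subgroup preserving each block. For $\rho\in\Sigma_p$ put $\underline r^{\rho}=(r_{\rho^{-1}(1)},\dots,r_{\rho^{-1}(p)})$ and let $\rho^*\in\Sigma_n$ be the permutation that maps the $i$-th block of $\underline r$ onto the $\rho(i)$-th block of $\underline r^\rho$ in an order-preserving way. For $\underline q\in\operatorname{Comp}_s(p)$ put $\underline q\rhd\underline r=\big(\sum_{j\in\underline q_1}r_j,\dots,\sum_{j\in\underline q_s}r_j\big)\in\operatorname{Comp}_s(n)$. For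 $l+m=r_1$ put $\underline r\circ_1(l,m)=(l,m,r_2,\dots,r_p)$. The group $\Sigma_n$ acts on $A^{\otimes n}$ by $\sigma\cdot(a_1\otimes\cdots\otimes a_n)=a_{\sigma^{-1}(1)}\otimes\cdots\otimes a_{\sigma^{-1}(n)}$ and diagonally on $\mathcal M(n)\otimes A^{\otimes n}$. **The category $\Gamma(\mathcal M)_{mod}$.** For an $\mathbb F$-vector space $A$ let $\Gamma(\mathcal M,A)=\bigoplus_{n\ge0}(\mathcal M(n)\otimes A^{\otimes n})^{\Sigma_n}$, which is functorial in $A$. The objects of $\Gamma(\mathcal M)_{mod}$ are the pairs $(A,f)$ of an $\mathbb F$-vector space $A$ and a linear map $f:\Gamma(\mathcal M,A)\to A$; a morphism $(A,f)\to(A',f')$ is a linear map $g:A\to A'$ with $f'\circ\Gamma(\mathcal M,g)=g\circ f$. **The category $\beta(\mathcal M)$.** Its objects are the pairs $(A,\beta)$ of an $\mathbb F$-vector space $A$ and a family of maps $\beta_{x,\underline r}:A^{\times p}\to A$, one for all $p,n\ge0$, $\underline r\in\operatorname{Comp}_p(n)$ and $x\in\mathcal M(n)^{\Sigma_{\underline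 r}}$, such that: * ($\beta$1) $\beta_{x,\underline r}((a_i)_i)=\beta_{\rho^*\cdot x,\underline r^\rho}((a_{\rho^{-1}(i)})_i)$ for all $\rho\in\Sigma_p$; * ($\beta$2) $\beta_{x,(0,r_1,\dots,r_p)}(a_0,a_1,\dots,a_p)=\beta_{x,(r_1,\dots,r_p)}(a_1,\dots,a_p)$; * ($\beta$3) $\beta_{x,\underline r}(\lambda a_1,a_2,\dots,a_p)=\lambda^{r_1}\beta_{x,\underline r}(a_1,\dots,a_p)$ for all $\lambda\in\mathbb F$ and $p\ge1$; * ($\beta$4) for $\underline q\in\operatorname{Comp}_s(p)$, $\ \beta_{x,\underline r}(\underbrace{a_1,\dots,a_1}_{q_1},\dots,\underbrace{a_s,\dots,a_s}_{q_s})=\beta_{\sum_{\sigma\in\Sigma_{\underline q\rhd\underline r}/\Sigma_{\underline r}}\sigma\cdot x,\ \underline q\rhd\underline r}(a_1,\dots,a_s)$; * ($\beta$5) $\beta_{x,\underline r}(a_0+a_1,a_2,\dots,a_p)=\sum_{l+m=r_1}\beta_{x,\underline r\circ_1(l,m)}(a_0,a_1,a_2,\dots,a_p)$ for $p\ge1$;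 * ($\beta$6) $\beta_{\lambda x+y,\underline r}=\lambda\beta_{x,\underline r}+\beta_{y,\underline r}$ for all $\lambda\in\mathbb F$ and $x,y\in\mathcal M(n)^{\Sigma_{\underline r}}$. The morphisms are the linear maps compatible with all the operations $\beta_{x,\underline r}$. **The functor $F_{\mathcal M}$.** It sends $(A,f)$ to $(A,\beta)$ with $$\beta_{x,\underline r}(a_1,\dots,a_p)=f\Big(\sum_{\sigma\in\Sigma_n/\Sigma_{\underline r}}\sigma\cdot x\otimes\sigma\cdot\big(a_1^{\otimes r_1}\otimes\cdots\otimes a_p^{\otimes r_p}\big)\Big)$$ and is the identity on underlying linear maps; it is a well-defined functor $\Gamma(\mathcal M)_{mod}\to\beta(\mathcal M)$. **Proposition.** For every $\Sigma$-module $\mathcal M$, the functor $F_{\mathcal M}:\Gamma(\mathcal M)_{mod}\to\beta(\mathcal M)$ is an isomorphism of categories. -/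

import Mathlib

open scoped TensorProduct DirectSum
open CategoryTheory

universe u v w

noncomputable section

namespace DividedPower

/-! ### Compositions of integers, blocks and Young subgroups -/

/-- `Comp p n`: the `p`-tuples of non-negative integers with sum `n`. -/
structure Comp (p n : ℕ) where
  /-- the parts -/
  parts : Fin p → ℕ
  sum_parts : ∑ i, parts i = n

namespace Comp

variable {p s n : ℕ}

/-- The lexicographic identification of pairs (block `i`, position in the block `i`) with
`Fin n`; it lists the blocks of consecutive integers of lengths `r₁, …, r_p` one after the other. -/
def blockEquiv (r : Comp p n) : (Σ i : Fin p, Fin (r.parts i)) ≃ Fin n :=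
  finSigmaFinEquiv.trans (finCongr r.sum_parts)

/-- The function `Fin n → Fin p` sending an element to the index of the block that contains it. -/
def block (r : Comp p n) (j : Fin n) : Fin p := (r.blockEquiv.symm j).1

/-- The Young subgroup of `r`: the permutations that preserve every block of `r`. -/
def young (r : Comp p n) : Subgroup (Equiv.Perm (Fin n)) where
  carrier := {σ | ∀ j, r.block (σ j) = r.block j}
  one_mem' := fun _ => rfl
  mul_mem' := fun {σ τ} hσ hτ j => (hσ (τ j)).trans (hτ j)
  inv_mem' := fun {σ} hσ j => by
    have h := hσ (σ⁻¹ j)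
    rw [show σ (σ⁻¹ j) = j from σ.apply_symm_apply j] at h
    exact h.symm

/-- The permuted composition `r^ρ = (r_{ρ⁻¹(1)}, …, r_{ρ⁻¹(p)})`. -/
def perm (r : Comp p n) (ρ : Equiv.Perm (Fin p)) : Comp p n :=
  ⟨fun i => r.parts (ρ⁻¹ i), (Equiv.sum_comp ρ⁻¹ r.parts).trans r.sum_parts⟩

/-- The block permutation `ρ^*`: it sends the `i`-th block of `r` onto the `ρ(i)`-th block
of `r^ρ`, preserving the order inside the block. -/
def blockPerm (r : Comp p n) (ρ : Equiv.Perm (Fin p)) : Equiv.Perm (Fin n) :=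
  (r.blockEquiv.symm.trans (Equiv.sigmaCongr ρ fun i =>
    finCongr (congrArg r.parts (ρ.symm_apply_apply i).symm))).trans (r.perm ρ).blockEquiv

/-- The composition `(0, r₁, …, r_p)`. -/
def zeroCons (r : Comp p n) : Comp (p + 1) n :=
  ⟨Fin.cons 0 r.parts, by rw [Fin.sum_cons, r.sum_parts, zero_add]⟩

/-- The composition `r ∘₁ (l, m) = (l, m, r₂, …, r_p)`, for `l + m = r₁`. -/
def splitFirst (r : Comp (p + 1) n) (lm : Finset.HasAntidiagonal.antidiagonal (r.parts 0)) : Comp (p + 2) n :=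
  ⟨Fin.cons lm.1.1 (Fin.cons lm.1.2 (Fin.tail r.parts)), by
    rw [Fin.sum_cons, Fin.sum_cons, ← add_assoc, Finset.HasAntidiagonal.mem_antidiagonal.1 lm.2]
    exact (Fin.sum_univ_succ r.parts).symm.trans r.sum_parts⟩

/-- The composition `q ▷ r`, whose `i`-th part is the sum of the `r_j` over the
elements `j` of the `i`-th block of `q`. -/
def merge (q : Comp s p) (r : Comp p n) : Comp s n :=
  ⟨fun i => ∑ j with q.block j = i, r.parts j, (Finset.sum_fiberwise _ _ _).trans r.sum_parts⟩

/-! Basic facts on blocks. -/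

lemma block_blockEquiv (r : Comp p n) (y : Σ i : Fin p, Fin (r.parts i)) :
    r.block (r.blockEquiv y) = y.1 := by
  simp [block]

lemma blockEquiv_val (r : Comp p n) (y : Σ i : Fin p, Fin (r.parts i)) :
    (r.blockEquiv y : ℕ) = (∑ k with k < y.1, r.parts k) + y.2 := by
  have h : (r.blockEquiv y : ℕ) = ∑ i : Fin y.1, r.parts (Fin.castLE y.1.2.le i) + y.2 := by
    simp [blockEquiv]
  rw [h]
  congr 1
  refine Finset.sum_nbij (fun i => Fin.castLE y.1.2.le i) ?_ ?_ ?_ ?_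
  · intro i _
    simp only [Finset.mem_filter, Finset.mem_univ, true_and]
    exact i.2
  · intro i _ j _ hij
    simpa [Fin.ext_iff] using hij
  · intro k hk
    have hk' : k < y.1 := by simpa using hk
    exact ⟨⟨k, hk'⟩, by simp, by simp⟩
  · intro i _
    rfl

lemma block_monotone (r : Comp p n) : Monotone r.block := by
  intro j j' h
  obtain ⟨y, rfl⟩ := r.blockEquiv.surjective j
  obtain ⟨y', rfl⟩ := r.blockEquiv.surjective j'
  rw [block_blockEquiv, block_blockEquiv]
  by_contra! hlt
  rw [Fin.le_def, blockEquiv_val, blockEquiv_val] at h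
  have h1 : (∑ k with k < y'.1, r.parts k) + r.parts y'.1 ≤ ∑ k with k < y.1, r.parts k := by
    rw [add_comm, ← Finset.sum_insert (by simp)]
    refine Finset.sum_le_sum_of_subset ?_
    intro k hk
    simp only [Finset.mem_insert, Finset.mem_filter, Finset.mem_univ, true_and] at hk ⊢
    rcases hk with rfl | hk
    · exact hlt
    · exact hk.trans hlt
  have := y'.2.2
  omega

lemma card_block (r : Comp p n) (i : Fin p) :
    (Finset.univ.filter fun j => r.block j = i).card = r.parts i := by
  rw [← Fintype.card_fin (r.parts i), ← Finset.card_univ]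
  symm
  refine Finset.card_nbij (fun k => r.blockEquiv ⟨i, k⟩) ?_ ?_ ?_
  · intro k _
    simp [block_blockEquiv]
  · intro k _ k' _ h
    have := r.blockEquiv.injective h
    simpa using this
  · intro j hj
    obtain ⟨⟨i', k⟩, rfl⟩ := r.blockEquiv.surjective j
    simp only [Finset.coe_filter, Finset.mem_univ, true_and, Set.mem_ofPred_eq,
      block_blockEquiv] at hj
    subst hj
    exact ⟨k, by simp, rfl⟩

/-- A monotone function whose fibres have the sizes prescribed by `r` is the block function. -/
lemma eq_block (r : Comp p n) (d : Fin n → Fin p) (hd : Monotone d)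
    (hc : ∀ i, (Finset.univ.filter fun j => d j = i).card = r.parts i) : d = r.block := by
  have key : ∀ i : Fin p, ∀ j, d j < i ↔ r.block j < i := by
    intro i
    have hcard : ∀ e : Fin n → Fin p,
        (Finset.univ.filter fun j => e j < i).card =
          ∑ k with k < i, (Finset.univ.filter fun j => e j = k).card := by
      intro e
      rw [Finset.card_eq_sum_card_fiberwise (f := e) (t := Finset.univ.filter fun k => k < i)
        (by intro j hj; simpa using hj)]
      refine Finset.sum_congr rfl fun k hk => ?_
      congr 1
      ext j
      simp only [Finset.mem_filter, Finset.mem_univ, true_and] at hk ⊢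
      constructor
      · exact fun h => h.2
      · rintro rfl
        exact ⟨hk, rfl⟩
    have hEq : (Finset.univ.filter fun j => d j < i).card =
        (Finset.univ.filter fun j => r.block j < i).card := by
      rw [hcard, hcard]
      exact Finset.sum_congr rfl fun k _ => (hc k).trans (r.card_block k).symm
    have hset : (Finset.univ.filter fun j => d j < i) =
        (Finset.univ.filter fun j => r.block j < i) := by
      by_cases hsub : (Finset.univ.filter fun j => d j < i) ⊆
          (Finset.univ.filter fun j => r.block j < i)
      · exact Finset.eq_of_subset_of_card_le hsub hEq.ge
      · symm
        refine Finset.eq_of_subset_of_card_le ?_ hEq.le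
        obtain ⟨j, hj, hj'⟩ := Finset.not_subset.1 hsub
        intro k hk
        simp only [Finset.mem_filter, Finset.mem_univ, true_and, not_lt] at hj hj' hk ⊢
        have hkj : k ≤ j := by
          by_contra! hlt
          exact absurd (hj'.trans (r.block_monotone hlt.le)) (not_le.2 hk)
        exact (hd hkj).trans_lt hj
    intro j
    have := Finset.ext_iff.1 hset j
    simpa using this
  funext j
  refine le_antisymm ?_ ?_
  · by_contra! h
    exact lt_irrefl _ ((key _ _).2 h)
  · by_contra! h
    exact lt_irrefl _ ((key _ _).1 h)

lemma block_zeroCons (r : Comp p n) (j : Fin n) : r.zeroCons.block j = (r.block j).succ := by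
  refine (congrFun (eq_block r.zeroCons (fun j => (r.block j).succ) ?_ ?_) j).symm
  · exact fun a b h => Fin.succ_le_succ_iff.2 (r.block_monotone h)
  · intro i
    refine Fin.cases ?_ (fun i => ?_) i
    · simp [zeroCons, Fin.succ_ne_zero]
    · simp [zeroCons, card_block]

lemma block_merge (q : Comp s p) (r : Comp p n) (j : Fin n) :
    (q.merge r).block j = q.block (r.block j) := by
  refine (congrFun (eq_block (q.merge r) (fun j => q.block (r.block j)) ?_ ?_) j).symm
  · exact q.block_monotone.comp r.block_monotone
  · intro i
    rw [Finset.card_eq_sum_card_fiberwise (f := r.block)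
      (t := Finset.univ.filter fun k => q.block k = i) (by intro j hj; simpa using hj)]
    refine Finset.sum_congr rfl fun k hk => ?_
    rw [← r.card_block k]
    congr 1
    ext j
    simp only [Finset.mem_filter, Finset.mem_univ, true_and] at hk ⊢
    constructor
    · exact fun h => h.2
    · rintro rfl
      exact ⟨hk, rfl⟩

lemma block_splitFirst (r : Comp (p + 1) n) (lm : Finset.HasAntidiagonal.antidiagonal (r.parts 0)) (j : Fin n) :
    Fin.predAbove 0 ((r.splitFirst lm).block j) = r.block j := by
  refine congrFun (eq_block r (fun j => Fin.predAbove 0 ((r.splitFirst lm).block j)) ?_ ?_) j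
  · exact (Fin.predAbove_right_monotone 0).comp (block_monotone _)
  · intro i
    refine Fin.cases ?_ (fun i => ?_) i
    · have h0 := (r.splitFirst lm).card_block 0
      have h1 := (r.splitFirst lm).card_block 1
      have hsum : (r.splitFirst lm).parts 0 + (r.splitFirst lm).parts 1 = r.parts 0 :=
        Finset.HasAntidiagonal.mem_antidiagonal.1 lm.2
      rw [← hsum, ← h0, ← h1, ← Finset.card_union_of_disjoint]
      · congr 1
        ext j
        simp only [Finset.mem_filter, Finset.mem_univ, true_and, Finset.mem_union]
        generalize (r.splitFirst lm).block j = k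
        refine Fin.cases ?_ (fun k => ?_) k
        · simp
        · rw [← Fin.succ_zero_eq_one, Fin.succ_inj]
          simp
      · rw [Finset.disjoint_left]
        intro j hj hj'
        simp only [Finset.mem_filter, Finset.mem_univ, true_and] at hj hj'
        rw [hj] at hj'
        simp at hj'
    · have h := (r.splitFirst lm).card_block i.succ.succ
      have h' : (r.splitFirst lm).parts i.succ.succ = r.parts i.succ := rfl
      rw [← h', ← h]
      congr 1
      ext j
      simp only [Finset.mem_filter, Finset.mem_univ, true_and]
      generalize (r.splitFirst lm).block j = k
      refine Fin.cases ?_ (fun k => ?_) k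
      · simp [Fin.ext_iff]
      · simp

lemma block_blockPerm (r : Comp p n) (ρ : Equiv.Perm (Fin p)) (j : Fin n) :
    (r.perm ρ).block (r.blockPerm ρ j) = ρ (r.block j) := by
  simp only [blockPerm, block, Equiv.trans_apply, Equiv.symm_apply_apply]
  rfl

lemma young_zeroCons (r : Comp p n) : r.zeroCons.young = r.young := by
  ext σ
  change (∀ j, _ = _) ↔ (∀ j, _ = _)
  simp [block_zeroCons]

lemma young_le_merge (q : Comp s p) (r : Comp p n) : r.young ≤ (q.merge r).young := by
  intro σ hσ j
  rw [block_merge, block_merge, hσ j]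

lemma young_splitFirst_le (r : Comp (p + 1) n) (lm : Finset.HasAntidiagonal.antidiagonal (r.parts 0)) :
    (r.splitFirst lm).young ≤ r.young := by
  intro σ hσ j
  rw [← r.block_splitFirst lm, ← r.block_splitFirst lm, hσ j]

end Comp

/-! ### Sums over cosets -/

section CosetSum

variable {F : Type*} [CommRing F] {G : Type*} [Group G] {V : Type*} [AddCommGroup V]
  [Module F V]

/-- For a vector `v` fixed by the subgroup `H`, this is the sum `∑_{σ ∈ G/H} σ · v`; each coset
contributes the value on a representative, which does not depend on the representative. -/
def cosetSum [Finite G] (ρ : Representation F G V) (H : Subgroup G) (v : V) : V :=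
  letI := Fintype.ofFinite (G ⧸ H)
  ∑ c : G ⧸ H, ρ c.out v

variable (ρ : Representation F G V) (H : Subgroup G)

lemma apply_out {v : V} (hv : ∀ h ∈ H, ρ h v = v) (g : G) :
    ρ (QuotientGroup.mk g : G ⧸ H).out v = ρ g v := by
  obtain ⟨h, hh⟩ := QuotientGroup.mk_out_eq_mul H g
  rw [hh, map_mul, Module.End.mul_apply, hv h h.2]

lemma cosetSum_fixed [Finite G] {v : V} (hv : ∀ h ∈ H, ρ h v = v) (g : G) :
    ρ g (cosetSum ρ H v) = cosetSum ρ H v := by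
  let _ := Fintype.ofFinite (G ⧸ H)
  unfold cosetSum
  rw [map_sum]
  conv_rhs => rw [← Equiv.sum_comp (MulAction.toPerm g : Equiv.Perm (G ⧸ H))]
  refine Finset.sum_congr rfl fun c _ => ?_
  have : (MulAction.toPerm g : Equiv.Perm (G ⧸ H)) c = QuotientGroup.mk (g * c.out) := by
    conv_lhs => rw [← QuotientGroup.out_eq' c]
    rfl
  rw [this, apply_out ρ H hv, map_mul, Module.End.mul_apply]

lemma cosetSum_trans [Finite G] (K : Subgroup G) (hHK : H ≤ K) {v : V} (hv : ∀ h ∈ H, ρ h v = v) :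
    cosetSum ρ H v = cosetSum ρ K (cosetSum (ρ.comp K.subtype) (H.subgroupOf K) v) := by
  let _ := Fintype.ofFinite (G ⧸ H)
  let _ := Fintype.ofFinite (G ⧸ K)
  let _ := Fintype.ofFinite (K ⧸ H.subgroupOf K)
  unfold cosetSum
  rw [← Equiv.sum_comp (Subgroup.quotientEquivProdOfLE hHK).symm, Fintype.sum_prod_type]
  refine Finset.sum_congr rfl fun c _ => ?_
  rw [map_sum]
  refine Finset.sum_congr rfl fun k _ => ?_
  have : (Subgroup.quotientEquivProdOfLE hHK).symm (c, k) =
      QuotientGroup.mk (c.out * (k.out : G)) := by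
    conv_lhs => rw [← QuotientGroup.out_eq' k]
    rfl
  rw [this, apply_out ρ H hv, map_mul]
  rfl

end CosetSum

/-! ### Σ-modules and the functor `Γ(M)` -/

/-- A `Σ`-module: a sequence of linear representations of the symmetric groups. -/
structure SigmaModule (F : Type u) [Field F] where
  /-- the component of arity `n` -/
  obj : ℕ → Type v
  [grp : ∀ n, AddCommGroup (obj n)]
  [mod : ∀ n, Module F (obj n)]
  /-- the action of the symmetric group on `n` letters -/
  rep : ∀ n, Representation F (Equiv.Perm (Fin n)) (obj n)

attribute [instance] SigmaModule.grp SigmaModule.mod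

section Gamma

variable {F : Type u} [Field F]

/-- The place permutation action on the tensor power `A^{⊗ n}`:
`σ · (a₁ ⊗ ⋯ ⊗ a_n) = a_{σ⁻¹(1)} ⊗ ⋯ ⊗ a_{σ⁻¹(n)}`. -/
def tensorRep (F : Type u) [Field F] (A : Type w) [AddCommGroup A] [Module F A] (n : ℕ) :
    Representation F (Equiv.Perm (Fin n)) (⨂[F] _ : Fin n, A) where
  toFun σ := (PiTensorProduct.reindex F (fun _ => A) σ).toLinearMap
  map_one' := by
    ext a
    simp [Equiv.Perm.one_def]
  map_mul' σ τ := by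
    ext a
    simp
    rfl

variable (M : SigmaModule.{u, v} F) (A : Type w) [AddCommGroup A] [Module F A]
  (B : Type w) [AddCommGroup B] [Module F B]

/-- The diagonal action on `M(n) ⊗ A^{⊗ n}`. -/
def diagRep (n : ℕ) :
    Representation F (Equiv.Perm (Fin n)) (M.obj n ⊗[F] (⨂[F] _ : Fin n, A)) :=
  Representation.tprod (M.rep n) (tensorRep F A n)

/-- `Γ(M, A) = ⨁_n (M(n) ⊗ A^{⊗ n})^{Σ_n}`. -/
abbrev Gamma : Type (max u v w) :=
  ⨁ n : ℕ, Representation.invariants (diagRep M A n)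

variable {A B}

lemma tensorRep_tprod {n : ℕ} (σ : Equiv.Perm (Fin n)) (a : Fin n → A) :
    tensorRep F A n σ (PiTensorProduct.tprod F a) =
      PiTensorProduct.tprod F (fun j => a (σ⁻¹ j)) := by
  simp [tensorRep]

lemma diagRep_tmul {n : ℕ} (σ : Equiv.Perm (Fin n)) (x : M.obj n) (a : Fin n → A) :
    diagRep M A n σ (x ⊗ₜ PiTensorProduct.tprod F a) =
      M.rep n σ x ⊗ₜ PiTensorProduct.tprod F (fun j => a (σ⁻¹ j)) := by
  rw [diagRep, Representation.tprod_apply, TensorProduct.map_tmul, tensorRep_tprod]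

/-- The map `id ⊗ g^{⊗ n}` on `M(n) ⊗ A^{⊗ n}`. -/
def tensorMap (g : A →ₗ[F] B) (n : ℕ) :
    (M.obj n ⊗[F] (⨂[F] _ : Fin n, A)) →ₗ[F] (M.obj n ⊗[F] (⨂[F] _ : Fin n, B)) :=
  TensorProduct.map LinearMap.id (PiTensorProduct.map fun _ => g)

lemma tensorMap_tmul (g : A →ₗ[F] B) {n : ℕ} (x : M.obj n) (a : Fin n → A) :
    tensorMap M g n (x ⊗ₜ PiTensorProduct.tprod F a) =
      x ⊗ₜ PiTensorProduct.tprod F (fun j => g (a j)) := by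
  simp [tensorMap]

lemma tensorMap_diagRep (g : A →ₗ[F] B) {n : ℕ} (σ : Equiv.Perm (Fin n))
    (t : M.obj n ⊗[F] (⨂[F] _ : Fin n, A)) :
    tensorMap M g n (diagRep M A n σ t) = diagRep M B n σ (tensorMap M g n t) := by
  have : tensorMap M g n ∘ₗ diagRep M A n σ = diagRep M B n σ ∘ₗ tensorMap M g n := by
    ext x a
    simp [diagRep_tmul, tensorMap_tmul]
  exact LinearMap.congr_fun this t

/-- `Γ(M, g) : Γ(M, A) → Γ(M, B)` for a linear map `g : A → B`. -/
def Gamma.map (g : A →ₗ[F] B) : Gamma M A →ₗ[F] Gamma M B :=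
  DirectSum.lmap fun n => (tensorMap M g n).restrict fun t ht σ => by
    rw [← tensorMap_diagRep, ht σ]

end Gamma

/-! ### Invariants of `M(n)` under Young subgroups -/

section Young

variable {F : Type u} [Field F] (M : SigmaModule.{u, v} F) {p s n : ℕ}

/-- The subspace `M(n)^{Σ_r}` of the elements of `M(n)` fixed by the Young subgroup of `r`. -/
def SigmaModule.inv (r : Comp p n) : Submodule F (M.obj n) :=
  Representation.invariants ((M.rep n).comp r.young.subtype)

variable {M}

lemma inv_apply {r : Comp p n} (x : M.inv r) (σ : Equiv.Perm (Fin n)) (hσ : σ ∈ r.young) :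
    M.rep n σ x.1 = x.1 :=
  x.2 ⟨σ, hσ⟩

/-- `x` seen as an element of `M(n)^{Σ_t}`, for a subgroup `Σ_t` of `Σ_r`. -/
def invOfLE {p' : ℕ} {r : Comp p n} {t : Comp p' n} (h : t.young ≤ r.young) (x : M.inv r) :
    M.inv t :=
  ⟨x.1, fun σ => inv_apply x σ.1 (h σ.2)⟩

/-- The element `ρ^* · x` of `M(n)^{Σ_{r^ρ}}`. -/
def invPerm (r : Comp p n) (ρ : Equiv.Perm (Fin p)) (x : M.inv r) : M.inv (r.perm ρ) :=
  ⟨M.rep n (r.blockPerm ρ) x.1, fun σ => by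
    have hmem : (r.blockPerm ρ)⁻¹ * σ.1 * r.blockPerm ρ ∈ r.young := by
      intro j
      apply ρ.injective
      rw [← r.block_blockPerm, ← r.block_blockPerm]
      have h := σ.2 (r.blockPerm ρ j)
      simpa using h
    have h := inv_apply x _ hmem
    change M.rep n σ.1 (M.rep n (r.blockPerm ρ) x.1) = _
    conv_rhs => rw [← h]
    simp only [← Module.End.mul_apply, ← map_mul]
    congr 2
    group⟩

/-- The element `∑_{σ ∈ Σ_{q ▷ r} / Σ_r} σ · x` of `M(n)^{Σ_{q ▷ r}}`. -/
def invMerge (q : Comp s p) (r : Comp p n) (x : M.inv r) : M.inv (q.merge r) :=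
  ⟨cosetSum ((M.rep n).comp (q.merge r).young.subtype)
      (r.young.subgroupOf (q.merge r).young) x.1,
    cosetSum_fixed _ _ fun h hh => inv_apply x h.1 hh⟩

end Young

/-! ### The two categories -/

section Categories

variable {F : Type u} [Field F]

/-- An object `(A, f)` of `Γ(M)_mod`: a vector space `A` and a linear map `f : Γ(M, A) → A`. -/
structure GammaMod (M : SigmaModule.{u, v} F) where
  /-- the underlying vector space -/
  carrier : Type w
  [grp : AddCommGroup carrier]
  [mod : Module F carrier]
  /-- the structure map -/
  str : Gamma M carrier →ₗ[F] carrier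

attribute [instance] GammaMod.grp GammaMod.mod

/-- A morphism of `Γ(M)_mod`: a linear map `g` with `f' ∘ Γ(M, g) = g ∘ f`. -/
@[ext]
structure GammaMod.Hom {M : SigmaModule.{u, v} F} (X Y : GammaMod.{u, v, w} M) where
  /-- the underlying linear map -/
  lin : X.carrier →ₗ[F] Y.carrier
  comm : Y.str ∘ₗ Gamma.map M lin = lin ∘ₗ X.str

lemma Gamma.map_id (M : SigmaModule.{u, v} F) (A : Type w) [AddCommGroup A] [Module F A] :
    Gamma.map M (LinearMap.id : A →ₗ[F] A) = LinearMap.id := by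
  refine DirectSum.linearMap_ext _ fun n => LinearMap.ext fun t => ?_
  simp only [Gamma.map, LinearMap.comp_apply, DirectSum.lmap_lof, LinearMap.id_apply]
  congr 1
  apply Subtype.ext
  simp [tensorMap, PiTensorProduct.map_id]

lemma Gamma.map_comp (M : SigmaModule.{u, v} F) {A B C : Type w} [AddCommGroup A] [Module F A]
    [AddCommGroup B] [Module F B] [AddCommGroup C] [Module F C] (h : B →ₗ[F] C) (g : A →ₗ[F] B) :
    Gamma.map M (h ∘ₗ g) = Gamma.map M h ∘ₗ Gamma.map M g := by
  refine DirectSum.linearMap_ext _ fun n => LinearMap.ext fun t => ?_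
  simp only [Gamma.map, LinearMap.comp_apply, DirectSum.lmap_lof]
  congr 1
  apply Subtype.ext
  have : tensorMap M (h ∘ₗ g) n = tensorMap M h n ∘ₗ tensorMap M g n := by
    ext x a
    simp [tensorMap_tmul]
  exact LinearMap.congr_fun this t.1

instance GammaMod.category (M : SigmaModule.{u, v} F) : Category (GammaMod.{u, v, w} M) where
  Hom X Y := GammaMod.Hom X Y
  id X := ⟨LinearMap.id, by rw [Gamma.map_id]; rfl⟩
  comp {X Y Z} g h := ⟨h.lin ∘ₗ g.lin, by
    rw [Gamma.map_comp, ← LinearMap.comp_assoc, h.comm, LinearMap.comp_assoc, g.comm,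
      LinearMap.comp_assoc]⟩

/-- A family of operations `β_{x,r} : A^p → A`, one for each composition `r` of an integer `n`
into `p` parts and each `x` in `M(n)^{Σ_r}`. -/
abbrev BetaOps (M : SigmaModule.{u, v} F) (A : Type w) : Type (max v w) :=
  ∀ {p n : ℕ} (r : Comp p n), M.inv r → (Fin p → A) → A

/-- The six relations that the operations `β_{x,r}` have to satisfy. -/
structure BetaRelations (M : SigmaModule.{u, v} F) (A : Type w) [AddCommGroup A] [Module F A]
    (β : BetaOps M A) : Prop where
  /-- `β_{x,r}((a_i)_i) = β_{ρ^*·x, r^ρ}((a_{ρ⁻¹(i)})_i)`. -/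
  perm : ∀ {p n : ℕ} (r : Comp p n) (ρ : Equiv.Perm (Fin p)) (x : M.inv r) (a : Fin p → A),
    β r x a = β (r.perm ρ) (invPerm r ρ x) (fun i => a (ρ⁻¹ i))
  /-- `β_{x,(0,r₁,…,r_p)}(a₀,a₁,…,a_p) = β_{x,(r₁,…,r_p)}(a₁,…,a_p)`. -/
  zero : ∀ {p n : ℕ} (r : Comp p n) (x : M.inv r) (a₀ : A) (a : Fin p → A),
    β r.zeroCons (invOfLE r.young_zeroCons.le x) (Fin.cons a₀ a) = β r x a
  /-- `β_{x,r}(c a₁,a₂,…,a_p) = c^{r₁} β_{x,r}(a₁,…,a_p)`. -/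
  smul : ∀ {p n : ℕ} (r : Comp (p + 1) n) (x : M.inv r) (c : F) (a₁ : A) (a : Fin p → A),
    β r x (Fin.cons (c • a₁) a) = c ^ r.parts 0 • β r x (Fin.cons a₁ a)
  /-- `β_{x,r}(a₁,…,a₁,…,a_s,…,a_s) = β_{∑ σ·x, q ▷ r}(a₁,…,a_s)`, where `a_i` is repeated `q_i`
  times and `σ` runs over `Σ_{q ▷ r} / Σ_r`. -/
  repeated : ∀ {p s n : ℕ} (q : Comp s p) (r : Comp p n) (x : M.inv r) (a : Fin s → A),
    β r x (fun j => a (q.block j)) = β (q.merge r) (invMerge q r x) a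
  /-- `β_{x,r}(a₀+a₁,a₂,…,a_p) = ∑_{l+m=r₁} β_{x,r∘₁(l,m)}(a₀,a₁,a₂,…,a_p)`. -/
  add : ∀ {p n : ℕ} (r : Comp (p + 1) n) (x : M.inv r) (a₀ a₁ : A) (a : Fin p → A),
    β r x (Fin.cons (a₀ + a₁) a) =
      ∑ lm : Finset.HasAntidiagonal.antidiagonal (r.parts 0),
        β (r.splitFirst lm) (invOfLE (r.young_splitFirst_le lm) x) (Fin.cons a₀ (Fin.cons a₁ a))
  /-- `β_{c x + y, r} = c β_{x,r} + β_{y,r}`. -/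
  lin : ∀ {p n : ℕ} (r : Comp p n) (c : F) (x y : M.inv r) (a : Fin p → A),
    β r (c • x + y) a = c • β r x a + β r y a

/-- An object `(A, β)` of the category `β(M)`. -/
structure BetaMod (M : SigmaModule.{u, v} F) where
  /-- the underlying vector space -/
  carrier : Type w
  [grp : AddCommGroup carrier]
  [mod : Module F carrier]
  /-- the operations -/
  op : BetaOps M carrier
  rel : BetaRelations M carrier op

attribute [instance] BetaMod.grp BetaMod.mod

/-- A morphism of `β(M)`: a linear map compatible with all the operations. -/
@[ext]
structure BetaMod.Hom {M : SigmaModule.{u, v} F} (X Y : BetaMod.{u, v, w} M) where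
  /-- the underlying linear map -/
  lin : X.carrier →ₗ[F] Y.carrier
  comm : ∀ {p n : ℕ} (r : Comp p n) (x : M.inv r) (a : Fin p → X.carrier),
    lin (X.op r x a) = Y.op r x (fun i => lin (a i))

instance BetaMod.category (M : SigmaModule.{u, v} F) : Category (BetaMod.{u, v, w} M) where
  Hom X Y := BetaMod.Hom X Y
  id X := ⟨LinearMap.id, fun _ _ _ => rfl⟩
  comp {X Y Z} g h := ⟨h.lin ∘ₗ g.lin, fun r x a => by
    rw [LinearMap.comp_apply, g.comm, h.comm]; rfl⟩

end Categories

/-! ### The functor `F_M` -/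

section FunctorF

variable {F : Type u} [Field F] {M : SigmaModule.{u, v} F} {A : Type w} [AddCommGroup A]
  [Module F A] {p s n : ℕ}

/-- The tensor `x ⊗ (a₁^{⊗ r₁} ⊗ ⋯ ⊗ a_p^{⊗ r_p})` of `M(n) ⊗ A^{⊗ n}`. -/
def blockTensor (r : Comp p n) (x : M.obj n) (a : Fin p → A) :
    M.obj n ⊗[F] (⨂[F] _ : Fin n, A) :=
  x ⊗ₜ PiTensorProduct.tprod F (fun j => a (r.block j))

lemma blockTensor_fixed (r : Comp p n) (x : M.inv r) (a : Fin p → A) (σ : Equiv.Perm (Fin n))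
    (hσ : σ ∈ r.young) :
    diagRep M A n σ (blockTensor r x.1 a) = blockTensor r x.1 a := by
  rw [blockTensor, diagRep_tmul, inv_apply x σ hσ]
  congr 2
  funext j
  rw [r.young.inv_mem hσ j]

/-- The element `∑_{σ ∈ Σ_n / Σ_r} σ·x ⊗ σ·(a₁^{⊗ r₁} ⊗ ⋯ ⊗ a_p^{⊗ r_p})` of
`(M(n) ⊗ A^{⊗ n})^{Σ_n}`. -/
def orbitElt (r : Comp p n) (x : M.inv r) (a : Fin p → A) :
    Representation.invariants (diagRep M A n) :=
  ⟨cosetSum (diagRep M A n) r.young (blockTensor r x.1 a),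
    cosetSum_fixed _ _ (blockTensor_fixed r x a)⟩

/-- The coefficient of `orbitElt r x a` along the tensor with `j`-th factor `a (d j)`. -/
def coef (r : Comp p n) (x : M.inv r) (d : Fin n → Fin p) : M.obj n :=
  letI := Fintype.ofFinite (Equiv.Perm (Fin n) ⧸ r.young)
  ∑ c : Equiv.Perm (Fin n) ⧸ r.young,
    if (fun j => r.block (c.out⁻¹ j)) = d then M.rep n c.out x.1 else 0

lemma orbitElt_eq (r : Comp p n) (x : M.inv r) (a : Fin p → A) :
    (orbitElt r x a).1 =
      ∑ d : Fin n → Fin p, coef r x d ⊗ₜ PiTensorProduct.tprod F (fun j => a (d j)) := by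
  let _ := Fintype.ofFinite (Equiv.Perm (Fin n) ⧸ r.young)
  simp only [orbitElt, cosetSum, coef, TensorProduct.sum_tmul]
  rw [Finset.sum_comm]
  refine Finset.sum_congr rfl fun c _ => ?_
  rw [Finset.sum_eq_single (fun j => r.block (c.out⁻¹ j))]
  · rw [if_pos rfl, blockTensor, diagRep_tmul]
  · intro d _ hd
    rw [if_neg (Ne.symm hd), TensorProduct.zero_tmul]
  · intro h
    exact absurd (Finset.mem_univ _) h

lemma coef_block (r : Comp p n) (x : M.inv r) (g : Equiv.Perm (Fin n)) (d : Fin n → Fin p)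
    (hd : ∀ j, d (g j) = r.block j) : coef r x d = M.rep n g x.1 := by
  let _ := Fintype.ofFinite (Equiv.Perm (Fin n) ⧸ r.young)
  simp only [coef]
  have hout := apply_out (M.rep n) r.young (inv_apply x) g
  obtain ⟨h, hh⟩ := QuotientGroup.mk_out_eq_mul r.young g
  rw [Finset.sum_eq_single (QuotientGroup.mk g)]
  · rw [if_pos, hout]
    funext j
    rw [hh, mul_inv_rev, Equiv.Perm.mul_apply, r.young.inv_mem h.2, ← hd]
    simp
  · intro c _ hc
    rw [if_neg]
    intro he
    apply hc
    rw [← QuotientGroup.out_eq' c]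
    refine QuotientGroup.eq.2 fun j => ?_
    rw [Equiv.Perm.mul_apply, congrFun he (g j), hd]
  · intro h
    exact absurd (Finset.mem_univ _) h

lemma exists_perm (r : Comp p n) (d : Fin n → Fin p)
    (hd : ∀ i, (Finset.univ.filter fun j => d j = i).card = r.parts i) :
    ∃ g : Equiv.Perm (Fin n), ∀ j, d (g j) = r.block j := by
  have e : ∀ i, {j // r.block j = i} ≃ {j // d j = i} := fun i =>
    Fintype.equivOfCardEq (by
      rw [Fintype.card_subtype, Fintype.card_subtype, hd, r.card_block])
  refine ⟨((Equiv.sigmaFiberEquiv r.block).symm.trans (Equiv.sigmaCongrRight e)).trans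
    (Equiv.sigmaFiberEquiv d), fun j => ?_⟩
  exact (e (r.block j) ⟨j, rfl⟩).2

lemma coef_eq_zero (r : Comp p n) (x : M.inv r) (d : Fin n → Fin p) (i : Fin p)
    (hd : (Finset.univ.filter fun j => d j = i).card ≠ r.parts i) : coef r x d = 0 := by
  let _ := Fintype.ofFinite (Equiv.Perm (Fin n) ⧸ r.young)
  refine Finset.sum_eq_zero fun c _ => if_neg ?_
  rintro rfl
  apply hd
  rw [← r.card_block i]
  refine Finset.card_nbij (fun j => c.out⁻¹ j) ?_ ?_ ?_
  · intro j hj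
    simpa using hj
  · intro j _ k _ h
    exact (c.out⁻¹).injective h
  · intro j hj
    refine ⟨c.out j, ?_, ?_⟩
    · simpa using hj
    · simp

lemma orbitElt_perm (r : Comp p n) (ρ : Equiv.Perm (Fin p)) (x : M.inv r) (a : Fin p → A) :
    orbitElt r x a = orbitElt (r.perm ρ) (invPerm r ρ x) (fun i => a (ρ⁻¹ i)) := by
  apply Subtype.ext
  rw [orbitElt_eq, orbitElt_eq]
  refine Fintype.sum_equiv ((Equiv.refl (Fin n)).arrowCongr ρ) _ _ fun d => ?_
  have h1 : coef (r.perm ρ) (invPerm r ρ x) ((Equiv.refl (Fin n)).arrowCongr ρ d) =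
      coef r x d := by
    by_cases hd : ∀ i, (Finset.univ.filter fun j => d j = i).card = r.parts i
    · obtain ⟨g, hg⟩ := exists_perm r d hd
      rw [coef_block r x g d hg, coef_block (r.perm ρ) _ (g * (r.blockPerm ρ)⁻¹)]
      · change M.rep n _ (M.rep n _ _) = _
        rw [← Module.End.mul_apply, ← map_mul, inv_mul_cancel_right]
      · intro j
        obtain ⟨k, rfl⟩ := (r.blockPerm ρ).surjective j
        rw [r.block_blockPerm, ← hg k]
        simp
    · push Not at hd
      obtain ⟨i, hi⟩ := hd
      rw [coef_eq_zero r x d i hi, coef_eq_zero (r.perm ρ) _ _ (ρ i)]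
      simpa [Comp.perm] using hi
  rw [h1]
  simp

lemma orbitElt_zero (r : Comp p n) (x : M.inv r) (a₀ : A) (a : Fin p → A) :
    orbitElt r.zeroCons (invOfLE r.young_zeroCons.le x) (Fin.cons a₀ a) = orbitElt r x a := by
  apply Subtype.ext
  have h : blockTensor r.zeroCons x.1 (Fin.cons a₀ a : Fin (p + 1) → A) = blockTensor r x.1 a := by
    simp [blockTensor, Comp.block_zeroCons]
  change cosetSum _ _ (blockTensor r.zeroCons x.1 (Fin.cons a₀ a : Fin (p + 1) → A)) = _
  rw [h, r.young_zeroCons]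
  rfl

lemma orbitElt_lin (r : Comp p n) (c : F) (x y : M.inv r) (a : Fin p → A) :
    orbitElt r (c • x + y) a = c • orbitElt r x a + orbitElt r y a := by
  apply Subtype.ext
  let _ := Fintype.ofFinite (Equiv.Perm (Fin n) ⧸ r.young)
  simp only [orbitElt, cosetSum, blockTensor, Submodule.coe_add, Submodule.coe_smul,
    TensorProduct.add_tmul, map_add, Finset.sum_add_distrib, Finset.smul_sum,
    ← TensorProduct.smul_tmul', map_smul]

lemma orbitElt_smul (r : Comp (p + 1) n) (x : M.inv r) (c : F) (a₁ : A) (a : Fin p → A) :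
    orbitElt r x (Fin.cons (c • a₁) a) = c ^ r.parts 0 • orbitElt r x (Fin.cons a₁ a) := by
  apply Subtype.ext
  have h : blockTensor r x.1 (Fin.cons (c • a₁) a : Fin (p + 1) → A) =
      c ^ r.parts 0 • blockTensor r x.1 (Fin.cons a₁ a : Fin (p + 1) → A) := by
    rw [blockTensor, blockTensor, ← TensorProduct.tmul_smul, ← r.card_block 0]
    have h1 : (fun j => (Fin.cons (c • a₁) a : Fin (p + 1) → A) (r.block j)) =
        fun j => (if r.block j = 0 then c else 1) •
          (Fin.cons a₁ a : Fin (p + 1) → A) (r.block j) := by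
      funext j
      generalize r.block j = k
      refine Fin.cases ?_ (fun k => ?_) k
      · simp
      · simp
    rw [h1, MultilinearMap.map_smul_univ, Finset.prod_ite]
    simp
  let _ := Fintype.ofFinite (Equiv.Perm (Fin n) ⧸ r.young)
  simp only [orbitElt, cosetSum, h, map_smul, Submodule.coe_smul, Finset.smul_sum]

lemma orbitElt_repeated (q : Comp s p) (r : Comp p n) (x : M.inv r) (a : Fin s → A) :
    orbitElt r x (fun j => a (q.block j)) = orbitElt (q.merge r) (invMerge q r x) a := by
  apply Subtype.ext
  change cosetSum _ _ _ = cosetSum _ _ _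
  rw [cosetSum_trans (diagRep M A n) r.young (q.merge r).young (Comp.young_le_merge q r)
    (blockTensor_fixed r x _)]
  congr 1
  let _ := Fintype.ofFinite
    ((q.merge r).young ⧸ r.young.subgroupOf (q.merge r).young)
  simp only [invMerge, cosetSum, blockTensor, TensorProduct.sum_tmul, Comp.block_merge]
  refine Finset.sum_congr rfl fun c _ => ?_
  refine (diagRep_tmul M _ _ _).trans ?_
  congr 2
  funext j
  rw [← Comp.block_merge, ← Comp.block_merge]
  exact congrArg a ((q.merge r).young.inv_mem c.out.2 j)

lemma coef_add (r : Comp (p + 1) n) (x : M.inv r) (e : Fin n → Fin (p + 2)) :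
    coef r x (fun j => Fin.predAbove 0 (e j)) =
      ∑ lm : Finset.HasAntidiagonal.antidiagonal (r.parts 0),
        coef (r.splitFirst lm) (invOfLE (r.young_splitFirst_le lm) x) e := by
  by_cases hd : ∀ i, (Finset.univ.filter fun j => Fin.predAbove 0 (e j) = i).card = r.parts i
  · have h0 : (Finset.univ.filter fun j => e j = 0).card +
        (Finset.univ.filter fun j => e j = 1).card = r.parts 0 := by
      rw [← hd 0, ← Finset.card_union_of_disjoint]
      · congr 1
        ext j
        simp only [Finset.mem_filter, Finset.mem_univ, true_and, Finset.mem_union]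
        generalize e j = k
        refine Fin.cases ?_ (fun k => ?_) k
        · simp
        · rw [← Fin.succ_zero_eq_one, Fin.succ_inj]
          simp
      · rw [Finset.disjoint_left]
        intro j hj hj'
        simp only [Finset.mem_filter, Finset.mem_univ, true_and] at hj hj'
        rw [hj] at hj'
        simp at hj'
    have hs : ∀ i : Fin p, (Finset.univ.filter fun j => e j = i.succ.succ).card =
        r.parts i.succ := by
      intro i
      rw [← hd i.succ]
      congr 1
      ext j
      simp only [Finset.mem_filter, Finset.mem_univ, true_and]
      generalize e j = k
      refine Fin.cases ?_ (fun k => ?_) k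
      · simp [Fin.ext_iff]
      · simp
    let lm : Finset.HasAntidiagonal.antidiagonal (r.parts 0) :=
      ⟨(_, _), Finset.HasAntidiagonal.mem_antidiagonal.2 h0⟩
    rw [Finset.sum_eq_single lm]
    · obtain ⟨g, hg⟩ := exists_perm (r.splitFirst lm) e (by
        intro i
        refine Fin.cases rfl (fun i => ?_) i
        exact Fin.cases rfl (fun i => hs i) i)
      rw [coef_block _ _ g e hg, coef_block r x g]
      · rfl
      · intro j
        rw [hg, r.block_splitFirst]
    · intro lm' _ hne
      by_cases h : (Finset.univ.filter fun j => e j = 0).card = lm'.1.1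
      · refine coef_eq_zero _ _ _ 1 fun h' => hne ?_
        exact Subtype.ext (Prod.ext h.symm h'.symm)
      · exact coef_eq_zero _ _ _ 0 h
    · intro h
      exact absurd (Finset.mem_univ _) h
  · push Not at hd
    obtain ⟨i, hi⟩ := hd
    rw [coef_eq_zero r x _ i hi]
    symm
    refine Finset.sum_eq_zero fun lm _ => ?_
    by_cases he : ∀ i, (Finset.univ.filter fun j => e j = i).card = (r.splitFirst lm).parts i
    · obtain ⟨g, hg⟩ := exists_perm (r.splitFirst lm) e he
      exfalso
      apply hi
      rw [← r.card_block i]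
      symm
      refine Finset.card_nbij (fun j => g j) ?_ ?_ ?_
      · intro j hj
        simpa [hg, r.block_splitFirst] using hj
      · intro j _ k _ h
        exact g.injective h
      · intro j hj
        obtain ⟨k, rfl⟩ := g.surjective j
        exact ⟨k, by simpa [hg, r.block_splitFirst] using hj, rfl⟩
    · push Not at he
      obtain ⟨k, hk⟩ := he
      exact coef_eq_zero _ _ _ k hk

lemma orbitElt_add (r : Comp (p + 1) n) (x : M.inv r) (a₀ a₁ : A) (a : Fin p → A) :
    orbitElt r x (Fin.cons (a₀ + a₁) a) =
      ∑ lm : Finset.HasAntidiagonal.antidiagonal (r.parts 0),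
        orbitElt (r.splitFirst lm) (invOfLE (r.young_splitFirst_le lm) x)
          (Fin.cons a₀ (Fin.cons a₁ a)) := by
  apply Subtype.ext
  rw [Submodule.coe_sum]
  simp only [orbitElt_eq]
  rw [Finset.sum_comm]
  simp only [← TensorProduct.sum_tmul, ← coef_add]
  set a' : Fin (p + 2) → A := Fin.cons a₀ (Fin.cons a₁ a) with ha'
  have hsum : ∀ k : Fin (p + 1), (Fin.cons (a₀ + a₁) a : Fin (p + 1) → A) k =
      ∑ i with Fin.predAbove 0 i = k, a' i := by
    intro k
    rw [Finset.sum_filter, Fin.sum_univ_succ, Fin.sum_univ_succ]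
    refine Fin.cases ?_ (fun k => ?_) k
    · simp [ha']
    · have h0 : (0 : Fin (p + 1)) ≠ k.succ := (Fin.succ_ne_zero k).symm
      simp [ha', h0, Finset.sum_ite_eq']
  have hexp : ∀ d : Fin n → Fin (p + 1),
      PiTensorProduct.tprod F (fun j => (Fin.cons (a₀ + a₁) a : Fin (p + 1) → A) (d j)) =
        ∑ e : Fin n → Fin (p + 2), if (fun j => Fin.predAbove 0 (e j)) = d then
          PiTensorProduct.tprod F (fun j => a' (e j)) else 0 := by
    intro d
    simp only [hsum]
    rw [MultilinearMap.map_sum_finset, ← Finset.sum_filter]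
    refine Finset.sum_congr ?_ fun _ _ => rfl
    ext e
    simp [Fintype.mem_piFinset, funext_iff]
  simp only [hexp, TensorProduct.tmul_sum]
  rw [Finset.sum_comm]
  refine Finset.sum_congr rfl fun e _ => ?_
  rw [Finset.sum_eq_single (fun j => Fin.predAbove 0 (e j))]
  · rw [if_pos rfl]
  · intro d _ hd
    rw [if_neg (Ne.symm hd), TensorProduct.tmul_zero]
  · intro h
    exact absurd (Finset.mem_univ _) h

lemma tensorMap_orbitElt {B : Type w} [AddCommGroup B] [Module F B] (g : A →ₗ[F] B)
    (r : Comp p n) (x : M.inv r) (a : Fin p → A) :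
    tensorMap M g n (orbitElt r x a).1 = (orbitElt r x (fun i => g (a i))).1 := by
  let _ := Fintype.ofFinite (Equiv.Perm (Fin n) ⧸ r.young)
  simp only [orbitElt, cosetSum, map_sum, tensorMap_diagRep, blockTensor, tensorMap_tmul]

/-- The operation
`β_{x,r}(a₁,…,a_p) = f(∑_{σ ∈ Σ_n/Σ_r} σ·x ⊗ σ·(a₁^{⊗ r₁} ⊗ ⋯ ⊗ a_p^{⊗ r_p}))`. -/
def GammaMod.op (X : GammaMod.{u, v, w} M) : BetaOps M X.carrier := fun {_ n} r x a =>
  X.str (DirectSum.lof F ℕ (fun n => Representation.invariants (diagRep M X.carrier n)) n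
    (orbitElt r x a))

lemma GammaMod.op_rel (X : GammaMod.{u, v, w} M) : BetaRelations M X.carrier X.op where
  perm r ρ x a := by simp only [GammaMod.op]; rw [orbitElt_perm r ρ x a]
  zero r x a₀ a := by simp only [GammaMod.op]; rw [orbitElt_zero]
  smul r x c a₁ a := by simp only [GammaMod.op]; rw [orbitElt_smul, map_smul, map_smul]
  repeated q r x a := by simp only [GammaMod.op]; rw [orbitElt_repeated]
  add r x a₀ a₁ a := by simp only [GammaMod.op]; rw [orbitElt_add, map_sum, map_sum]
  lin r c x y a := by
    simp only [GammaMod.op]; rw [orbitElt_lin, map_add, map_add, map_smul, map_smul]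

/-- The functor `F_M : Γ(M)_mod → β(M)`, `(A, f) ↦ (A, β)`, which is the identity on the
underlying vector spaces and linear maps. -/
def functorF (M : SigmaModule.{u, v} F) : GammaMod.{u, v, w} M ⥤ BetaMod.{u, v, w} M where
  obj X := ⟨X.carrier, X.op, X.op_rel⟩
  map {X Y} g := ⟨g.lin, fun {p n} r x a => by
    have h := LinearMap.congr_fun g.comm (DirectSum.lof F ℕ
      (fun n => Representation.invariants (diagRep M X.carrier n)) n (orbitElt r x a))
    refine h.symm.trans ?_
    simp only [GammaMod.op, LinearMap.comp_apply, Gamma.map, DirectSum.lmap_lof]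
    congr 2
    exact Subtype.ext (tensorMap_orbitElt g.lin r x a)⟩

end FunctorF

end DividedPower

end

/-!
An operation `β_{x,r}` is the value of the sought structure map `f` on an orbit element, so `f` is
unique once the orbit elements are known to span the invariants, and it exists once the pairs
`(orbitElt r x a, β_{x,r}(a))` are known to span the graph of a linear map. Orbit elements and
operations obey the same relations, which allow one to rewrite a pair with entries `a_i` in the
linear span of a set `S` as a combination of pairs with entries in `S`. Taking for `S` a basis
of `A`, any combination of pairs becomes a sum `∑_r (orbitElt r x_r b, β_{x_r,r}(b))` for one
tuple `b` of distinct basis vectors. There the coordinates of the invariant return every `x_r`, so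
the second component is determined by the first one.
-/

noncomputable section

namespace DividedPower

/-! ### Compositions as fibre sizes -/

attribute [ext] Comp

namespace Comp

variable {p s n : ℕ}

lemma parts_le (r : Comp p n) (i : Fin p) : r.parts i ≤ n :=
  (Finset.single_le_sum (fun _ _ => Nat.zero_le _) (Finset.mem_univ i)).trans_eq r.sum_parts

instance : Fintype (Comp p n) :=
  Fintype.ofInjective (fun r i => (⟨r.parts i, Nat.lt_succ_of_le (r.parts_le i)⟩ : Fin (n + 1)))
    fun _ _ h => Comp.ext <| funext fun i => congrArg Fin.val (congrFun h i)

/-- The composition whose `i`-th part is the number of elements of the fibre of `d` over `i`. It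
indexes the orbit of `d` under the permutations of `Fin n`. -/
def fiberCard (d : Fin n → Fin p) : Comp p n :=
  ⟨fun i => (Finset.univ.filter fun j => d j = i).card, by
    rw [← Finset.card_eq_sum_card_fiberwise fun j _ => Finset.mem_coe.2 (Finset.mem_univ (d j)),
      Finset.card_univ, Fintype.card_fin]⟩

lemma fiberCard_block (r : Comp p n) : fiberCard r.block = r :=
  Comp.ext <| funext r.card_block

lemma block_fiberCard_of_monotone {d : Fin n → Fin p} (hd : Monotone d) :
    (fiberCard d).block = d :=
  (eq_block _ d hd fun _ => rfl).symm

lemma exists_eq_block_comp_perm (h : Fin p → Fin s) :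
    ∃ (q : Comp s p) (ρ : Equiv.Perm (Fin p)), h = q.block ∘ ρ :=
  ⟨fiberCard (h ∘ Tuple.sort h), (Tuple.sort h)⁻¹, by
    rw [block_fiberCard_of_monotone (Tuple.monotone_sort h)]
    ext j
    simp⟩

lemma exists_eq_zeroCons {r : Comp (p + 1) n} (h : r.parts 0 = 0) :
    ∃ t : Comp p n, r = t.zeroCons := by
  have hsum : ∑ i, Fin.tail r.parts i = n := by
    have h_parts := r.sum_parts
    rwa [Fin.sum_univ_succ, h, zero_add] at h_parts
  exact ⟨⟨Fin.tail r.parts, hsum⟩, Comp.ext (funext (Fin.cases h fun _ => rfl))⟩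

end Comp

variable {F : Type u} [Field F] {M : SigmaModule.{u, v} F} {A : Type w} [AddCommGroup A]
  [Module F A] {p s n : ℕ}

/-! ### Coefficients of orbit elements -/

lemma coef_block_self (r : Comp p n) (x : M.inv r) : coef r x r.block = x := by
  rw [coef_block r x 1 _ fun _ => rfl, map_one, Module.End.one_apply]

lemma coef_eq_zero_of_ne_fiberCard {r : Comp p n} (x : M.inv r) {d : Fin n → Fin p}
    (h : r ≠ Comp.fiberCard d) : coef r x d = 0 := by
  obtain ⟨i, hi⟩ := Function.ne_iff.1 fun h' => h (Comp.ext h')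
  exact coef_eq_zero r x d i hi.symm

lemma sum_coef (x : ∀ r : Comp p n, M.inv r) (d : Fin n → Fin p) :
    ∑ r, coef r (x r) d = coef (Comp.fiberCard d) (x (Comp.fiberCard d)) d :=
  Fintype.sum_eq_single _ fun r hr => coef_eq_zero_of_ne_fiberCard (x r) hr

lemma sum_coef_block (x : ∀ r : Comp p n, M.inv r) (t : Comp p n) :
    ∑ r, coef r (x r) t.block = x t := by
  rw [sum_coef, Comp.fiberCard_block, coef_block_self]

lemma sum_coef_of_equivariant (T : (Fin n → Fin p) → M.obj n)
    (hT : ∀ (σ : Equiv.Perm (Fin n)) d, M.rep n σ (T (d ∘ σ)) = T d)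
    (x : ∀ r : Comp p n, M.inv r) (hx : ∀ r, (x r : M.obj n) = T r.block) (d : Fin n → Fin p) :
    ∑ r, coef r (x r) d = T d := by
  obtain ⟨g, hg⟩ := exists_perm (Comp.fiberCard d) d fun _ => rfl
  have hdg : d ∘ g = (Comp.fiberCard d).block := funext hg
  rw [sum_coef, coef_block _ _ g d hg, hx, ← hdg, hT]

/-! ### Coordinates of invariant tensors -/

/-- The component `(M(n) ⊗ A^{⊗ n})^{Σ_n}` of `Γ(M, A)`. -/
abbrev tensorInvariants (M : SigmaModule.{u, v} F) (A : Type w) [AddCommGroup A] [Module F A]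
    (n : ℕ) : Submodule F (M.obj n ⊗[F] (⨂[F] _ : Fin n, A)) :=
  Representation.invariants (diagRep M A n)

/-- The sum over all compositions `r` of `n` into `p` parts of the orbit elements of the `x r` on
one tuple `a`. -/
def orbitSum (x : ∀ r : Comp p n, M.inv r) (a : Fin p → A) : tensorInvariants M A n :=
  ∑ r, orbitElt r (x r) a

section Coordinates

variable {ι : Type*} (e : Module.Basis ι F A)

open Classical in
/-- The coordinates in `M(n)` of an element of `M(n) ⊗ A^{⊗ n}` with respect to the basis of
`A^{⊗ n}` induced by a basis of `A`. -/
def tensorCoord (M : SigmaModule.{u, v} F) (n : ℕ) :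
    (M.obj n ⊗[F] (⨂[F] _ : Fin n, A)) ≃ₗ[F] ((Fin n → ι) →₀ M.obj n) :=
  TensorProduct.equivFinsuppOfBasisRight (Basis.piTensorProduct fun _ : Fin n => e)

lemma tensorCoord_tmul (x : M.obj n) (a : Fin n → A) (D : Fin n → ι) :
    tensorCoord e M n (x ⊗ₜ PiTensorProduct.tprod F a) D = (∏ j, e.repr (a j) (D j)) • x := by
  classical
  rw [tensorCoord, TensorProduct.equivFinsuppOfBasisRight_apply_tmul_apply,
    Basis.piTensorProduct_repr_tprod_apply]

lemma tensorCoord_tmul_basis [DecidableEq ι] (x : M.obj n) (C D : Fin n → ι) :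
    tensorCoord e M n (x ⊗ₜ PiTensorProduct.tprod F (e ∘ C)) D = if C = D then x else 0 := by
  rw [tensorCoord_tmul]
  split_ifs with h
  · simp [h]
  · obtain ⟨j, hj⟩ := Function.ne_iff.1 h
    rw [Finset.prod_eq_zero (Finset.mem_univ j) (by simp [hj]), zero_smul]

lemma tensorCoord_diagRep (σ : Equiv.Perm (Fin n)) (t : M.obj n ⊗[F] (⨂[F] _ : Fin n, A))
    (D : Fin n → ι) :
    tensorCoord e M n (diagRep M A n σ t) D = M.rep n σ (tensorCoord e M n t (D ∘ σ)) := by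
  have : Finsupp.lapply D ∘ₗ (tensorCoord e M n).toLinearMap ∘ₗ diagRep M A n σ =
      M.rep n σ ∘ₗ Finsupp.lapply (D ∘ σ) ∘ₗ (tensorCoord e M n).toLinearMap := by
    ext x a
    have hprod : ∏ j, e.repr (a (σ⁻¹ j)) (D j) = ∏ j, e.repr (a j) (D (σ j)) := by
      rw [← Equiv.prod_comp σ]
      exact Finset.prod_congr rfl fun j _ => by rw [show σ⁻¹ (σ j) = j from σ.symm_apply_apply j]
    simp only [TensorProduct.AlgebraTensorModule.curry_apply, TensorProduct.curry_apply,
      LinearMap.compMultilinearMap_apply, LinearMap.coe_restrictScalars, LinearMap.comp_apply,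
      LinearEquiv.coe_coe, Finsupp.lapply_apply, diagRep_tmul, tensorCoord_tmul, map_smul, hprod,
      Function.comp_apply]
  exact LinearMap.congr_fun this t

lemma rep_tensorCoord (t : tensorInvariants M A n) (σ : Equiv.Perm (Fin n)) (D : Fin n → ι) :
    M.rep n σ (tensorCoord e M n t (D ∘ σ)) = tensorCoord e M n t D := by
  rw [← tensorCoord_diagRep, t.2 σ]

lemma tensorCoord_orbitElt [DecidableEq ι] (r : Comp p n) (x : M.inv r) (c : Fin p → ι)
    (D : Fin n → ι) :
    tensorCoord e M n (orbitElt r x (e ∘ c)) D =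
      ∑ d : Fin n → Fin p, if c ∘ d = D then coef r x d else 0 := by
  rw [orbitElt_eq, map_sum, Finsupp.finsetSum_apply]
  exact Finset.sum_congr rfl fun d _ => tensorCoord_tmul_basis e _ (c ∘ d) D

lemma tensorCoord_orbitSum_comp (x : ∀ r : Comp p n, M.inv r) {c : Fin p → ι}
    (hc : Function.Injective c) (d : Fin n → Fin p) :
    tensorCoord e M n (orbitSum x (e ∘ c)) (c ∘ d) = ∑ r, coef r (x r) d := by
  classical
  simp [orbitSum, tensorCoord_orbitElt, hc.comp_left.eq_iff]

lemma tensorCoord_orbitSum_eq_zero (x : ∀ r : Comp p n, M.inv r) {c : Fin p → ι} {D : Fin n → ι}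
    (hD : ¬ Set.range D ⊆ Set.range c) : tensorCoord e M n (orbitSum x (e ∘ c)) D = 0 := by
  classical
  have hne (d : Fin n → Fin p) : c ∘ d ≠ D := by
    rintro rfl
    exact hD (Set.range_comp_subset_range d c)
  simp [orbitSum, tensorCoord_orbitElt, hne]

lemma orbitSum_injective {c : Fin p → ι} (hc : Function.Injective c) :
    Function.Injective fun x : ∀ r : Comp p n, M.inv r => orbitSum x (e ∘ c) := by
  intro x y hxy
  ext r
  rw [← sum_coef_block x, ← sum_coef_block y, ← tensorCoord_orbitSum_comp e x hc,
    ← tensorCoord_orbitSum_comp e y hc]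
  exact congrArg (fun t : tensorInvariants M A n => tensorCoord e M n t (c ∘ r.block)) hxy

/-- The coordinate of an invariant tensor along the basis vectors `e (c i)` repeated according
to `r`; it is fixed by the Young subgroup of `r`. -/
def blockCoord (t : tensorInvariants M A n) (c : Fin p → ι) (r : Comp p n) : M.inv r :=
  ⟨tensorCoord e M n t (c ∘ r.block), fun σ => by
    have hσ : (c ∘ r.block) ∘ σ.1 = c ∘ r.block := funext fun j => congrArg c (σ.2 j)
    have h := rep_tensorCoord e t σ.1 (c ∘ r.block)
    rwa [hσ] at h⟩

lemma orbitSum_blockCoord (t : tensorInvariants M A n) {c : Fin p → ι}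
    (hc : Function.Injective c)
    (ht : ∀ D ∈ (tensorCoord e M n t).support, Set.range D ⊆ Set.range c) :
    orbitSum (blockCoord e t c) (e ∘ c) = t := by
  refine Subtype.ext ((tensorCoord e M n).injective (Finsupp.ext fun D => ?_))
  by_cases hD : Set.range D ⊆ Set.range c
  · obtain ⟨d, rfl⟩ := Set.range_subset_range_iff_exists_comp.1 hD
    rw [tensorCoord_orbitSum_comp e _ hc]
    exact sum_coef_of_equivariant (fun d => tensorCoord e M n t (c ∘ d))
      (fun σ d => rep_tensorCoord e t σ (c ∘ d)) _ (fun _ => rfl) d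
  · rw [tensorCoord_orbitSum_eq_zero e _ hD, Finsupp.notMem_support_iff.1 fun h => hD (ht D h)]

lemma exists_orbitSum_eq (t : tensorInvariants M A n) :
    ∃ (p : ℕ) (c : Fin p → ι) (x : ∀ r : Comp p n, M.inv r), orbitSum x (e ∘ c) = t := by
  have hfin : (⋃ D ∈ (tensorCoord e M n t).support, Set.range D).Finite :=
    Set.Finite.biUnion (Finset.finite_toSet _) fun D _ => Set.finite_range D
  obtain ⟨p, c, hc, hrange⟩ := hfin.fin_param
  refine ⟨p, c, blockCoord e t c, orbitSum_blockCoord e t hc fun D hD => ?_⟩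
  rw [hrange]
  exact Set.subset_biUnion_of_mem (u := fun D : Fin n → ι => Set.range D) hD

end Coordinates

lemma linearMap_ext_orbitElt {V : Type*} [AddCommGroup V] [Module F V]
    {f g : tensorInvariants M A n →ₗ[F] V}
    (h : ∀ {p : ℕ} (r : Comp p n) (x : M.inv r) (a : Fin p → A),
      f (orbitElt r x a) = g (orbitElt r x a)) : f = g := by
  ext1 t
  obtain ⟨p, c, x, rfl⟩ := exists_orbitSum_eq (Module.Basis.ofVectorSpace F A) t
  simp only [orbitSum, map_sum, h]

/-! ### The graph spanned by orbit elements and operations -/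

lemma isLinearMap_of_map_smul_add {R V W : Type*} [Ring R] [AddCommGroup V] [Module R V]
    [AddCommGroup W] [Module R W] {f : V → W}
    (h : ∀ (c : R) (x y : V), f (c • x + y) = c • f x + f y) : IsLinearMap R f where
  map_add x y := by simpa using h 1 x y
  map_smul c x := by
    have h_zero : f 0 = 0 := by simpa using h 1 0 0
    simpa [h_zero] using h c x 0

namespace BetaRelations

variable {β : BetaOps M A} (hβ : BetaRelations M A β)

/-- The linear map `x ↦ (orbitElt r x a, β_{x,r}(a))`. -/
def opPair (r : Comp p n) (a : Fin p → A) : M.inv r →ₗ[F] tensorInvariants M A n × A :=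
  IsLinearMap.mk' (fun x => (orbitElt r x a, β r x a)) <| isLinearMap_of_map_smul_add
    fun c x y => Prod.ext (orbitElt_lin r c x y a) (hβ.lin r c x y a)

lemma opPair_apply (r : Comp p n) (a : Fin p → A) (x : M.inv r) :
    hβ.opPair r a x = (orbitElt r x a, β r x a) := rfl

lemma opPair_perm (r : Comp p n) (ρ : Equiv.Perm (Fin p)) (a : Fin p → A) (x : M.inv r) :
    hβ.opPair r a x = hβ.opPair (r.perm ρ) (a ∘ ⇑ρ⁻¹) (invPerm r ρ x) :=
  Prod.ext (orbitElt_perm r ρ x a) (hβ.perm r ρ x a)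

lemma opPair_comp_block (q : Comp s p) (r : Comp p n) (a : Fin s → A) (x : M.inv r) :
    hβ.opPair r (a ∘ q.block) x = hβ.opPair (q.merge r) a (invMerge q r x) :=
  Prod.ext (orbitElt_repeated q r x a) (hβ.repeated q r x a)

lemma opPair_zeroCons (r : Comp p n) (a₀ : A) (a : Fin p → A) (x : M.inv r.zeroCons) :
    hβ.opPair r.zeroCons (Fin.cons a₀ a) x = hβ.opPair r a (invOfLE r.young_zeroCons.ge x) :=
  Prod.ext (orbitElt_zero r (invOfLE r.young_zeroCons.ge x) a₀ a)
    (hβ.zero r (invOfLE r.young_zeroCons.ge x) a₀ a)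

lemma opPair_cons_smul (r : Comp (p + 1) n) (c : F) (a₁ : A) (a : Fin p → A) (x : M.inv r) :
    hβ.opPair r (Fin.cons (c • a₁) a) x = c ^ r.parts 0 • hβ.opPair r (Fin.cons a₁ a) x :=
  Prod.ext (orbitElt_smul r x c a₁ a) (hβ.smul r x c a₁ a)

lemma opPair_cons_add (r : Comp (p + 1) n) (a₀ a₁ : A) (a : Fin p → A) (x : M.inv r) :
    hβ.opPair r (Fin.cons (a₀ + a₁) a) x =
      ∑ lm : Finset.HasAntidiagonal.antidiagonal (r.parts 0),
        hβ.opPair (r.splitFirst lm) (Fin.cons a₀ (Fin.cons a₁ a))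
          (invOfLE (r.young_splitFirst_le lm) x) := by
  simp only [opPair_apply, orbitElt_add, hβ.add, prod_mk_sum]

lemma exists_opPair_comp_eq (r : Comp p n) (h : Fin p → Fin s) (b : Fin s → A) (x : M.inv r) :
    ∃ (t : Comp s n) (y : M.inv t), hβ.opPair r (b ∘ h) x = hβ.opPair t b y := by
  obtain ⟨q, ρ, rfl⟩ := Comp.exists_eq_block_comp_perm h
  have hρ : (b ∘ q.block ∘ ρ) ∘ ⇑ρ⁻¹ = b ∘ q.block := by
    ext j
    simp
  refine ⟨q.merge (r.perm ρ), invMerge q _ (invPerm r ρ x), ?_⟩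
  rw [hβ.opPair_perm r ρ, hρ, opPair_comp_block]

lemma fst_sum_opPair (x : ∀ r : Comp p n, M.inv r) (a : Fin p → A) :
    (∑ r, hβ.opPair r a (x r)).1 = orbitSum x a := by
  simp only [Prod.fst_sum, opPair_apply, orbitSum]

/-- The span of the pairs `(orbitElt r x a, β_{x,r}(a))` over all tuples `a` with entries in `S`.
For `S = Set.univ` it is the graph of the linear map that induces the operations `β`. -/
def graph (n : ℕ) (S : Set A) : Submodule F (tensorInvariants M A n × A) :=
  Submodule.span F {w | ∃ (p : ℕ) (r : Comp p n) (a : Fin p → A) (x : M.inv r),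
    Set.range a ⊆ S ∧ hβ.opPair r a x = w}

variable {hβ} {S T : Set A}

lemma opPair_mem_graph (r : Comp p n) {a : Fin p → A} (x : M.inv r) (ha : Set.range a ⊆ S) :
    hβ.opPair r a x ∈ hβ.graph n S :=
  Submodule.subset_span ⟨p, r, a, x, ha, rfl⟩

lemma graph_le {N : Submodule F (tensorInvariants M A n × A)}
    (h : ∀ {p : ℕ} (r : Comp p n) (a : Fin p → A) (x : M.inv r),
      Set.range a ⊆ S → hβ.opPair r a x ∈ N) : hβ.graph n S ≤ N := by
  refine Submodule.span_le.2 ?_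
  rintro _ ⟨p, r, a, x, ha, rfl⟩
  exact h r a x ha

lemma graph_mono (h : S ⊆ T) : hβ.graph n S ≤ hβ.graph n T :=
  graph_le fun r _ x ha => opPair_mem_graph r x (ha.trans h)

lemma graph_range_le {b : Fin s → A} {N : Submodule F (tensorInvariants M A n × A)}
    (h : ∀ (r : Comp s n) (x : M.inv r), hβ.opPair r b x ∈ N) :
    hβ.graph n (Set.range b) ≤ N := by
  refine graph_le fun r a x ha => ?_
  obtain ⟨k, rfl⟩ := Set.range_subset_range_iff_exists_comp.1 ha
  obtain ⟨t, y, hty⟩ := hβ.exists_opPair_comp_eq r k b x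
  exact hty ▸ h t y

lemma graph_insert_le {z : A} {N : Submodule F (tensorInvariants M A n × A)}
    (h : ∀ {p : ℕ} (r : Comp (p + 1) n) (a : Fin p → A) (x : M.inv r),
      Set.range a ⊆ S → hβ.opPair r (Fin.cons z a) x ∈ N) : hβ.graph n (insert z S) ≤ N := by
  refine graph_le fun r a x ha => ?_
  obtain ⟨k, b, -, hb⟩ := ((Set.finite_range a).inter_of_left S).fin_param
  have hab : Set.range a ⊆ Set.range (Fin.cons z b : Fin (k + 1) → A) := fun y hy => by
    rw [Fin.range_cons, hb]
    exact (ha hy).imp_right fun hyS => ⟨hy, hyS⟩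
  have hbS : Set.range b ⊆ S := hb.trans_subset Set.inter_subset_right
  exact graph_range_le (fun t y => h t b y hbS) (opPair_mem_graph r x hab)

lemma graph_insert_zero_le : hβ.graph n (insert 0 S) ≤ hβ.graph n S := by
  refine graph_insert_le fun r a x ha => ?_
  by_cases h : r.parts 0 = 0
  · obtain ⟨t, rfl⟩ := Comp.exists_eq_zeroCons h
    rw [opPair_zeroCons]
    exact opPair_mem_graph t _ ha
  · rw [← smul_zero (0 : F), opPair_cons_smul, zero_pow h, zero_smul]
    exact Submodule.zero_mem _

lemma graph_insert_smul_le (c : F) (z : A) :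
    hβ.graph n (insert (c • z) S) ≤ hβ.graph n (insert z S) := by
  refine graph_insert_le fun r a x ha => ?_
  rw [opPair_cons_smul]
  refine Submodule.smul_mem _ _ (opPair_mem_graph r x ?_)
  rw [Fin.range_cons]
  exact Set.insert_subset_insert ha

lemma graph_insert_add_le (y z : A) :
    hβ.graph n (insert (y + z) S) ≤ hβ.graph n (insert y (insert z S)) := by
  refine graph_insert_le fun r a x ha => ?_
  rw [opPair_cons_add]
  refine Submodule.sum_mem _ fun lm _ => opPair_mem_graph _ _ ?_
  rw [Fin.range_cons, Fin.range_cons]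
  exact Set.insert_subset_insert (Set.insert_subset_insert ha)

lemma graph_insert_le_of_mem_span {z : A} (hz : z ∈ Submodule.span F S) :
    hβ.graph n (insert z S) ≤ hβ.graph n S := by
  suffices h : ∀ T, S ⊆ T → hβ.graph n (insert z T) ≤ hβ.graph n T from h S subset_rfl
  induction hz using Submodule.span_induction with
  | mem z hz => exact fun T hT => (congrArg (hβ.graph n) (Set.insert_eq_of_mem (hT hz))).le
  | zero => exact fun T _ => graph_insert_zero_le
  | add y z _ _ hy hz =>
    exact fun T hT => (graph_insert_add_le y z).trans <|
      (hy _ (hT.trans (Set.subset_insert z T))).trans (hz T hT)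
  | smul c z _ hz => exact fun T hT => (graph_insert_smul_le c z).trans (hz T hT)

lemma graph_span (S : Set A) : hβ.graph n (Submodule.span F S) = hβ.graph n S := by
  have h_union {T : Set A} (hT : T.Finite) (hTS : T ⊆ Submodule.span F S) :
      hβ.graph n (T ∪ S) ≤ hβ.graph n S := by
    induction T, hT using Set.Finite.induction_on with
    | empty => rw [Set.empty_union]
    | @insert z T _ _ ih =>
      obtain ⟨hz, hT⟩ := Set.insert_subset_iff.1 hTS
      rw [Set.insert_union]
      exact (graph_insert_le_of_mem_span
        (Submodule.span_mono Set.subset_union_right hz)).trans (ih hT)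
  refine le_antisymm (graph_le fun r a x ha => ?_) (graph_mono Submodule.subset_span)
  exact h_union (Set.finite_range a) ha (opPair_mem_graph r x Set.subset_union_left)

lemma exists_finite_subset_mem_graph {w : tensorInvariants M A n × A} (hw : w ∈ hβ.graph n S) :
    ∃ T ⊆ S, T.Finite ∧ w ∈ hβ.graph n T := by
  induction hw using Submodule.span_induction with
  | mem w hw =>
    obtain ⟨p, r, a, x, ha, rfl⟩ := hw
    exact ⟨Set.range a, ha, Set.finite_range a, opPair_mem_graph r x subset_rfl⟩
  | zero => exact ⟨∅, Set.empty_subset S, Set.finite_empty, Submodule.zero_mem _⟩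
  | add w w' _ _ h h' =>
    obtain ⟨T, hTS, hT, hw⟩ := h
    obtain ⟨T', hTS', hT', hw'⟩ := h'
    exact ⟨T ∪ T', Set.union_subset hTS hTS', hT.union hT', Submodule.add_mem _
      (graph_mono Set.subset_union_left hw) (graph_mono Set.subset_union_right hw')⟩
  | smul c w _ h =>
    obtain ⟨T, hTS, hT, hw⟩ := h
    exact ⟨T, hTS, hT, Submodule.smul_mem _ c hw⟩

lemma exists_sum_opPair_of_mem_graph_range {b : Fin s → A} {w : tensorInvariants M A n × A}
    (hw : w ∈ hβ.graph n (Set.range b)) :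
    ∃ x : ∀ r : Comp s n, M.inv r, ∑ r, hβ.opPair r b (x r) = w := by
  classical
  have hle : hβ.graph n (Set.range b) ≤
      LinearMap.range (LinearMap.lsum F (fun r : Comp s n => M.inv r) F fun r => hβ.opPair r b) :=
    graph_range_le fun r x => ⟨Pi.single r x, LinearMap.lsum_piSingle ..⟩
  obtain ⟨x, rfl⟩ := hle hw
  exact ⟨x, by simp [LinearMap.lsum_apply]⟩

lemma exists_sum_opPair_basis {ι : Type*} (e : Module.Basis ι F A)
    {w : tensorInvariants M A n × A} (hw : w ∈ hβ.graph n Set.univ) :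
    ∃ (p : ℕ) (c : Fin p → ι) (x : ∀ r : Comp p n, M.inv r),
      Function.Injective c ∧ ∑ r, hβ.opPair r (e ∘ c) (x r) = w := by
  rw [← Submodule.top_coe (R := F), ← e.span_eq, graph_span] at hw
  obtain ⟨T, hTe, hT, hw⟩ := exists_finite_subset_mem_graph hw
  obtain ⟨p, b, hb, rfl⟩ := hT.fin_param
  obtain ⟨c, rfl⟩ := Set.range_subset_range_iff_exists_comp.1 hTe
  obtain ⟨x, hx⟩ := exists_sum_opPair_of_mem_graph_range hw
  exact ⟨p, c, x, hb.of_comp, hx⟩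

lemma eq_zero_of_zero_mk_mem_graph {y : A} (h : (0, y) ∈ hβ.graph n Set.univ) : y = 0 := by
  let e := Module.Basis.ofVectorSpace F A
  obtain ⟨p, c, x, hc, hx⟩ := exists_sum_opPair_basis e h
  have h_orbitSum : orbitSum x (e ∘ c) = orbitSum 0 (e ∘ c) := by
    rw [← fst_sum_opPair hβ, ← fst_sum_opPair hβ, hx]
    simp only [Pi.zero_apply, map_zero, Finset.sum_const_zero, Prod.fst_zero]
  obtain rfl : x = 0 := orbitSum_injective e hc h_orbitSum
  simpa using congrArg Prod.snd hx.symm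

lemma bijective_fst_graph :
    Function.Bijective (Prod.fst ∘ (hβ.graph n Set.univ).subtype) := by
  constructor
  · rintro ⟨⟨t, y⟩, hy⟩ ⟨⟨t', y'⟩, hy'⟩ (rfl : t = t')
    have h_sub : (0, y - y') ∈ hβ.graph n Set.univ := by
      simpa using Submodule.sub_mem _ hy hy'
    obtain rfl := sub_eq_zero.1 (eq_zero_of_zero_mk_mem_graph h_sub)
    rfl
  · intro t
    obtain ⟨p, c, x, rfl⟩ := exists_orbitSum_eq (Module.Basis.ofVectorSpace F A) t
    exact ⟨⟨_, Submodule.sum_mem _ fun r _ => opPair_mem_graph r (x r) (Set.subset_univ _)⟩,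
      fst_sum_opPair hβ x _⟩

lemma exists_linearMap_orbitElt (hβ : BetaRelations M A β) (n : ℕ) :
    ∃ f : tensorInvariants M A n →ₗ[F] A,
      ∀ {p : ℕ} (r : Comp p n) (x : M.inv r) (a : Fin p → A), f (orbitElt r x a) = β r x a := by
  obtain ⟨f, hf⟩ := Submodule.exists_eq_graph (bijective_fst_graph (hβ := hβ) (n := n))
  refine ⟨f, fun r x a => ?_⟩
  have h := opPair_mem_graph (hβ := hβ) r x (Set.subset_univ (Set.range a))
  rw [hf, LinearMap.mem_graph_iff] at h
  exact h.symm

end BetaRelations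

/-! ### The inverse functor -/

namespace Gamma

/-- The orbit element of `(r, x, a)` as an element of the summand of index `n` of `Γ(M, A)`. -/
def orbit (r : Comp p n) (x : M.inv r) (a : Fin p → A) : Gamma M A :=
  DirectSum.lof F ℕ (fun n => tensorInvariants M A n) n (orbitElt r x a)

lemma linearMap_ext {V : Type*} [AddCommGroup V] [Module F V] {f g : Gamma M A →ₗ[F] V}
    (h : ∀ {p n : ℕ} (r : Comp p n) (x : M.inv r) (a : Fin p → A),
      f (orbit r x a) = g (orbit r x a)) : f = g :=
  DirectSum.linearMap_ext _ fun _ => linearMap_ext_orbitElt h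

lemma map_orbit {B : Type w} [AddCommGroup B] [Module F B] (g : A →ₗ[F] B) (r : Comp p n)
    (x : M.inv r) (a : Fin p → A) : map M g (orbit r x a) = orbit r x (g ∘ a) := by
  rw [map, orbit, DirectSum.lmap_lof]
  exact congrArg _ (Subtype.ext (tensorMap_orbitElt g r x a))

end Gamma

namespace BetaMod

/-- The structure map `Γ(M, A) → A` that induces the operations of an object of `β(M)`. -/
def str (X : BetaMod.{u, v, w} M) : Gamma M X.carrier →ₗ[F] X.carrier :=
  DirectSum.toModule F ℕ X.carrier fun n => (X.rel.exists_linearMap_orbitElt n).choose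

lemma str_orbit (X : BetaMod.{u, v, w} M) (r : Comp p n) (x : M.inv r) (a : Fin p → X.carrier) :
    X.str (Gamma.orbit r x a) = X.op r x a := by
  rw [str, Gamma.orbit, DirectSum.toModule_lof]
  exact (X.rel.exists_linearMap_orbitElt n).choose_spec r x a

end BetaMod

/-- The inverse of `functorF M`, the identity on underlying linear maps. -/
def functorG (M : SigmaModule.{u, v} F) : BetaMod.{u, v, w} M ⥤ GammaMod.{u, v, w} M where
  obj X := ⟨X.carrier, X.str⟩
  map {X Y} g := ⟨g.lin, Gamma.linearMap_ext fun r x a => by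
    rw [LinearMap.comp_apply, LinearMap.comp_apply, Gamma.map_orbit, X.str_orbit, Y.str_orbit,
      g.comm]
    rfl⟩

lemma str_functorF_obj (X : GammaMod.{u, v, w} M) : ((functorF M).obj X).str = X.str :=
  Gamma.linearMap_ext ((functorF M).obj X).str_orbit

lemma op_functorG_obj (X : BetaMod.{u, v, w} M) :
    @GammaMod.op _ _ _ ((functorG M).obj X) = @X.op := by
  funext p n r x a
  exact X.str_orbit r x a

lemma GammaMod.Hom.heq {A B : Type w} [AddCommGroup A] [Module F A] [AddCommGroup B] [Module F B]
    {f f' : Gamma M A →ₗ[F] A} {g g' : Gamma M B →ₗ[F] B} (hf : f = f') (hg : g = g')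
    {k : GammaMod.Hom ⟨A, f⟩ ⟨B, g⟩} {k' : GammaMod.Hom ⟨A, f'⟩ ⟨B, g'⟩}
    (h : k.lin = k'.lin) : k ≍ k' := by
  subst hf hg
  exact heq_of_eq (GammaMod.Hom.ext h)

lemma BetaMod.mk_congr {β γ : BetaOps M A} (h : @β = @γ) (hβ : BetaRelations M A β)
    (hγ : BetaRelations M A γ) : BetaMod.mk A β hβ = BetaMod.mk A γ hγ := by
  subst h
  rfl

lemma BetaMod.Hom.heq {A B : Type w} [AddCommGroup A] [Module F A] [AddCommGroup B] [Module F B]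
    {β β' : BetaOps M A} {γ γ' : BetaOps M B} (hβ : @β = @β') (hγ : @γ = @γ')
    {rβ : BetaRelations M A β} {rβ' : BetaRelations M A β'}
    {rγ : BetaRelations M B γ} {rγ' : BetaRelations M B γ'}
    {k : BetaMod.Hom ⟨A, β, rβ⟩ ⟨B, γ, rγ⟩} {k' : BetaMod.Hom ⟨A, β', rβ'⟩ ⟨B, γ', rγ'⟩}
    (h : k.lin = k'.lin) : k ≍ k' := by
  subst hβ hγ
  exact heq_of_eq (BetaMod.Hom.ext h)

lemma functorF_comp_functorG (M : SigmaModule.{u, v} F) :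
    functorF M ⋙ functorG M = 𝟭 (GammaMod.{u, v, w} M) :=
  Functor.hext (fun X => congrArg (GammaMod.mk X.carrier) (str_functorF_obj X))
    fun X Y _ => GammaMod.Hom.heq (str_functorF_obj X) (str_functorF_obj Y) rfl

lemma functorG_comp_functorF (M : SigmaModule.{u, v} F) :
    functorG M ⋙ functorF M = 𝟭 (BetaMod.{u, v, w} M) :=
  Functor.hext (fun X => BetaMod.mk_congr (A := X.carrier) (op_functorG_obj X) _ X.rel)
    fun X Y _ => BetaMod.Hom.heq (op_functorG_obj X) (op_functorG_obj Y) rfl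

end DividedPower

end

theorem mainTheorem4 {F : Type u} [Field F] (M : DividedPower.SigmaModule.{u, v} F) :
    ∃ G : DividedPower.BetaMod.{u, v, w} M ⥤ DividedPower.GammaMod.{u, v, w} M,
      DividedPower.functorF M ⋙ G = 𝟭 (DividedPower.GammaMod.{u, v, w} M) ∧
        G ⋙ DividedPower.functorF M = 𝟭 (DividedPower.BetaMod.{u, v, w} M) :=
  ⟨DividedPower.functorG M, DividedPower.functorF_comp_functorG M,
    DividedPower.functorG_comp_functorF M⟩
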